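/- Let $n\ge 3$ and let $B_n=\langle \sigma_1,\dots,\sigma_{n-1}\mid \sigma_i\sigma_j=\sigma_j\sigma_i\ (|i-j|>1),\ \sigma_i\sigma_{i+1}\sigma_i=\sigma_{i+1}\sigma_i\sigma_{i+1}\ (1\le i\le n-2)\rangle$ be the Artin braid group. For $1\le i<j\le n$ let $a_{ij}=(\sigma_{j-1}\cdots\sigma_{i+1})\,\sigma_i\,(\sigma_{j-1}\cdots\sigma_{i+1})^{-1}$ be the band generators, and let $\delta=\sigma_{n-1}\cdots\sigma_2\sigma_1$. Let $SQP(n)\subset B_n$ be the submonoid generated by the $a_{ij}$, and for $V,W\in B_n$ write $V\le W$ if $W=PVQ$ for some $P,Q\in SQP(n)$. For $\beta\in B_n$ define $$\inf(\beta)=\max\{r\in\mathbb Z\mid \delta^r\le\beta\},\qquad \sup(\beta)=\min\{s\in\mathbb Z\mid \beta\le\delta^s\},$$ let $\mathrm{nb}(\beta)$ be the minimal number of negative letters $a_{ij}^{-1}$ in a word in the letters $a_{ij}^{\pm1}$ representing $\beta$, and let $\mathrm{writhe}(\beta)$ be the exponent sum of $\beta$, that is, the image of $\beta$ under the homomorphism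 $B_n\to\mathbb Z$ with $\sigma_i\mapsto 1$ for all $i$. Let $\beta\in B_n$ with $\inf(\beta)\le -1$. * If $\inf(\beta)<0<\sup(\beta)$, then $\mathrm{nb}(\beta)\le (n-2)\,|\inf(\beta)|$. * If $\sup(\beta)\le 0$, then $\mathrm{nb}(\beta)=-\mathrm{writhe}(\beta)\le (n-2)\,|\inf(\beta)|+|\sup(\beta)|$. Moreover, if $n=3$, then equality holds in both cases: $\mathrm{nb}(\beta)=(n-2)|\inf(\beta)|$ in the first case, and $\mathrm{nb}(\beta)=-\mathrm{writhe}(\beta)=(n-2)|\inf(\beta)|+|\sup(\beta)|$ in the second. -/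

import Mathlib

/-- Indices `1, …, n - 1` of the Artin generators of the braid group on `n` strands. -/
abbrev ArtinIndex (n : ℕ) : Type := {i : ℕ // 1 ≤ i ∧ i < n}

/-- The Artin relators: `σ_i σ_j = σ_j σ_i` for `|i - j| > 1`, and
`σ_i σ_j σ_i = σ_j σ_i σ_j` for `j = i + 1`. -/
def artinRelators (n : ℕ) : Set (FreeGroup (ArtinIndex n)) :=
  {r | (∃ i j : ArtinIndex n, i.1 + 1 < j.1 ∧
          r = (FreeGroup.of i * FreeGroup.of j) * (FreeGroup.of j * FreeGroup.of i)⁻¹) ∨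
       (∃ i j : ArtinIndex n, i.1 + 1 = j.1 ∧
          r = (FreeGroup.of i * FreeGroup.of j * FreeGroup.of i) *
            (FreeGroup.of j * FreeGroup.of i * FreeGroup.of j)⁻¹)}

/-- The Artin braid group `B_n`. -/
def BraidGroup (n : ℕ) : Type := PresentedGroup (artinRelators n)

instance BraidGroup.instGroup (n : ℕ) : Group (BraidGroup n) :=
  inferInstanceAs (Group (PresentedGroup (artinRelators n)))

namespace BraidGroup

/-- The Artin generator with index `i`. -/
def gen {n : ℕ} (i : ArtinIndex n) : BraidGroup n :=
  PresentedGroup.of (rels := artinRelators n) i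

/-- The Artin generator `σ_i`, for `1 ≤ i ≤ n - 1` (and, by convention, `1` for other `i`;
these other values are never used below). -/
def sigma (n i : ℕ) : BraidGroup n :=
  if h : 1 ≤ i ∧ i < n then gen ⟨i, h⟩ else 1

/-- The descending product `σ_b σ_{b-1} ⋯ σ_a` (equal to `1` if `b < a`). -/
def sigmaDesc (n a b : ℕ) : BraidGroup n :=
  ((List.range (b + 1 - a)).map fun t => sigma n (b - t)).prod

/-- `δ = σ_{n-1} ⋯ σ_2 σ_1`. -/
def delta (n : ℕ) : BraidGroup n := sigmaDesc n 1 (n - 1)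

/-- Index set of the band generators: pairs `(i, j)` with `1 ≤ i < j ≤ n`. -/
abbrev BandIndex (n : ℕ) : Type := {p : ℕ × ℕ // 1 ≤ p.1 ∧ p.1 < p.2 ∧ p.2 ≤ n}

/-- The band generator
`a_{ij} = (σ_{j-1} ⋯ σ_{i+1}) σ_i (σ_{j-1} ⋯ σ_{i+1})⁻¹`. -/
def band {n : ℕ} (p : BandIndex n) : BraidGroup n :=
  sigmaDesc n (p.1.1 + 1) (p.1.2 - 1) * sigma n p.1.1 *
    (sigmaDesc n (p.1.1 + 1) (p.1.2 - 1))⁻¹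

/-- Words in the band generators and their inverses: the letter `(p, true)` is the positive band
`band p`, and `(p, false)` is the negative band `(band p)⁻¹`. -/
abbrev BandWord (n : ℕ) : Type := List (BandIndex n × Bool)

/-- The braid represented by a band word. -/
def BandWord.toBraid {n : ℕ} (W : BandWord n) : BraidGroup n :=
  (W.map fun x => if x.2 then band x.1 else (band x.1)⁻¹).prod

/-- The number of negative bands in a band word. -/
def BandWord.nb {n : ℕ} (W : BandWord n) : ℕ := W.countP fun x => !x.2

/-- The negative band number: the least number of negative bands in a band word
representing `β`. -/
noncomputable def nb {n : ℕ} (β : BraidGroup n) : ℕ :=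
  sInf {m : ℕ | ∃ W : BandWord n, W.toBraid = β ∧ W.nb = m}

/-- The monoid of braids represented by words in the positive bands only. -/
def SQP (n : ℕ) : Submonoid (BraidGroup n) := Submonoid.closure (Set.range band)

/-- The partial order `V ≤ W`: `W = P V Q` for some `P, Q` in the monoid of positive bands. -/
def Below {n : ℕ} (V W : BraidGroup n) : Prop :=
  ∃ P ∈ SQP n, ∃ Q ∈ SQP n, W = P * V * Q

/-- `inf β = max {r ∈ ℤ | δ ^ r ≤ β}`. -/
noncomputable def inf {n : ℕ} (β : BraidGroup n) : ℤ :=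
  sSup {r : ℤ | Below (delta n ^ r) β}

/-- `sup β = min {s ∈ ℤ | β ≤ δ ^ s}`. -/
noncomputable def sup {n : ℕ} (β : BraidGroup n) : ℤ :=
  sInf {s : ℤ | Below β (delta n ^ s)}

/-- The exponent-sum homomorphism `B_n → ℤ` with `σ_i ↦ 1` for all `i`. -/
def exponentSum (n : ℕ) : BraidGroup n →* Multiplicative ℤ :=
  PresentedGroup.toGroup (rels := artinRelators n)
    (f := fun _ : ArtinIndex n => Multiplicative.ofAdd (1 : ℤ)) (by
      rintro r (⟨i, j, -, rfl⟩ | ⟨i, j, -, rfl⟩) <;> simp)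

/-- The writhe of a braid: the number of positive letters minus the number of negative letters
in any word representing it. -/
def writhe {n : ℕ} (β : BraidGroup n) : ℤ := Multiplicative.toAdd (exponentSum n β)

end BraidGroup

/-! The dual Garside structure reduces everything to counting letters. Conjugation by `δ` permutes
the bands, and every band `a` satisfies `δ = a * X` with `X` a product of `n - 2` bands
(`isDualElement_delta`). Hence `β = δ ^ inf β * P` with `P` positive of some length `m`, and trading
each letter of `P` for `δ * X⁻¹` gives `sup β ≤ inf β + m`.

If `sup β > 0`, then `P` has more than `|inf β|` letters. Trading `|inf β|` of them cancels every
`δ⁻¹` at a cost of `n - 2` negative bands each (`nb_delta_zpow_mul_le`). If `sup β ≤ 0`, then `β⁻¹`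
is positive, so `nb β = -writhe β` (`nb_eq_neg_writhe`); the bound follows from `writhe β = (n - 1)
* inf β + m` and `m ≥ sup β - inf β`.

For `n = 3` the reverse inequalities are `-inf β ≤ nb β` (`neg_inf_le_nb`) and `m ≤ sup β - inf β`
(`length_le_sup_sub_inf`). -/

open BraidGroup

/-! ### Positive words and complements in an arbitrary group. -/

section BandMonoid

variable {G : Type*} [Group G] {S : Set G} {δ : G}

/-- `PositiveOfLength S m g`: the element `g` is a product of `m` elements of `S`. -/
def PositiveOfLength (S : Set G) (m : ℕ) (g : G) : Prop :=
  ∃ l : List G, (∀ x ∈ l, x ∈ S) ∧ l.length = m ∧ l.prod = g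

lemma PositiveOfLength.one : PositiveOfLength S 0 (1 : G) := ⟨[], by simp, rfl, rfl⟩

lemma PositiveOfLength.of_mem {a : G} (ha : a ∈ S) : PositiveOfLength S 1 a :=
  ⟨[a], by simpa using ha, rfl, by simp⟩

lemma PositiveOfLength.mul {p q : ℕ} {g h : G} (hg : PositiveOfLength S p g)
    (hh : PositiveOfLength S q h) : PositiveOfLength S (p + q) (g * h) := by
  obtain ⟨l, hl, rfl, rfl⟩ := hg
  obtain ⟨k, hk, rfl, rfl⟩ := hh
  refine ⟨l ++ k, ?_, by simp, by simp⟩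
  intro x hx
  rcases List.mem_append.1 hx with h | h
  exacts [hl x h, hk x h]

lemma PositiveOfLength.pow {p : ℕ} {g : G} (hg : PositiveOfLength S p g) (k : ℕ) :
    PositiveOfLength S (k * p) (g ^ k) := by
  induction k with
  | zero => simpa using PositiveOfLength.one
  | succ k ih => rw [pow_succ, add_one_mul]; exact ih.mul hg

lemma PositiveOfLength.eq_one {g : G} (hg : PositiveOfLength S 0 g) : g = 1 := by
  obtain ⟨l, -, h, rfl⟩ := hg
  simp [List.length_eq_zero_iff.1 h]

lemma PositiveOfLength.exists_mul {p q : ℕ} {g : G} (hg : PositiveOfLength S (p + q) g) :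
    ∃ x y, PositiveOfLength S p x ∧ PositiveOfLength S q y ∧ g = x * y := by
  obtain ⟨l, hl, h, rfl⟩ := hg
  refine ⟨(l.take p).prod, (l.drop p).prod,
    ⟨_, fun x hx => hl x (List.mem_of_mem_take hx), by simp [h], rfl⟩,
    ⟨_, fun x hx => hl x (List.mem_of_mem_drop hx), by simp [h], rfl⟩,
    (List.prod_take_mul_prod_drop l p).symm⟩

lemma PositiveOfLength.exists_cons {p : ℕ} {g : G} (hg : PositiveOfLength S (p + 1) g) :
    ∃ a ∈ S, ∃ y, PositiveOfLength S p y ∧ g = a * y := by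
  obtain ⟨l, hl, h, rfl⟩ := hg
  match l with
  | a :: l =>
    exact ⟨a, hl a (by simp), l.prod, ⟨l, fun x hx => hl x (by simp [hx]), by simpa using h, rfl⟩,
      by simp⟩

lemma mem_closure_iff_positiveOfLength {g : G} :
    g ∈ Submonoid.closure S ↔ ∃ m, PositiveOfLength S m g := by
  constructor
  · intro h
    obtain ⟨l, hl, rfl⟩ := Submonoid.exists_list_of_mem_closure h
    exact ⟨l.length, l, hl, rfl, rfl⟩
  · rintro ⟨m, l, hl, -, rfl⟩
    exact Submonoid.list_prod_mem _ fun x hx => Submonoid.subset_closure (hl x hx)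

lemma PositiveOfLength.map_eq {w : G →* Multiplicative ℤ} (hw : ∀ a ∈ S, (w a).toAdd = 1) {m : ℕ}
    {g : G} (hg : PositiveOfLength S m g) : (w g).toAdd = m := by
  induction m generalizing g with
  | zero => simp [hg.eq_one]
  | succ m ih =>
    obtain ⟨a, ha, y, hy, rfl⟩ := hg.exists_cons
    simp [hw a ha, ih hy, add_comm]

/-- `S` is stable under conjugation by `δ` and by `δ⁻¹`. -/
def ConjStable (S : Set G) (δ : G) : Prop :=
  ∀ a ∈ S, δ * a * δ⁻¹ ∈ S ∧ δ⁻¹ * a * δ ∈ S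

lemma PositiveOfLength.conj {h : G} (hS : ∀ a ∈ S, h * a * h⁻¹ ∈ S) {m : ℕ} {g : G}
    (hg : PositiveOfLength S m g) : PositiveOfLength S m (h * g * h⁻¹) := by
  induction m generalizing g with
  | zero => rw [hg.eq_one]; simpa using PositiveOfLength.one
  | succ m ih =>
    obtain ⟨a, ha, y, hy, rfl⟩ := hg.exists_cons
    have := (PositiveOfLength.of_mem (hS a ha)).mul (ih hy)
    rw [add_comm m 1]
    convert this using 1
    group

lemma ConjStable.inv (hS : ConjStable S δ) : ConjStable S δ⁻¹ := fun a ha => by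
  simpa [and_comm] using hS a ha

lemma ConjStable.pow (hS : ConjStable S δ) (k : ℕ) : ConjStable S (δ ^ k) := by
  induction k with
  | zero => intro a ha; simpa using ha
  | succ k ih =>
    intro a ha
    have h₁ := (ih _ (hS a ha).1).1
    have h₂ := (hS _ (ih a ha).2).2
    constructor
    · convert h₁ using 1; rw [pow_succ]; group
    · convert h₂ using 1; rw [pow_succ]; group

lemma ConjStable.zpow (hS : ConjStable S δ) (r : ℤ) : ConjStable S (δ ^ r) := by
  obtain ⟨k, rfl | rfl⟩ := r.eq_nat_or_neg
  · simpa using hS.pow k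
  · simpa using (hS.pow k).inv

lemma ConjStable.exists_mul_zpow (hS : ConjStable S δ) (r : ℤ) {m : ℕ} {g : G}
    (hg : PositiveOfLength S m g) : ∃ h, PositiveOfLength S m h ∧ g * δ ^ r = δ ^ r * h := by
  refine ⟨(δ ^ r)⁻¹ * g * (δ ^ r), ?_, by group⟩
  have := hg.conj (h := (δ ^ r)⁻¹) fun a ha => by simpa using (hS.zpow r a ha).2
  simpa using this

lemma ConjStable.exists_zpow_mul (hS : ConjStable S δ) (r : ℤ) {m : ℕ} {g : G}
    (hg : PositiveOfLength S m g) : ∃ h, PositiveOfLength S m h ∧ δ ^ r * g = h * δ ^ r := by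
  refine ⟨δ ^ r * g * (δ ^ r)⁻¹, ?_, by group⟩
  exact hg.conj fun a ha => (hS.zpow r a ha).1

/-- The part of the dual Garside structure that is used: conjugation by `δ` preserves `S`, and
every element of `S` has a positive complement of length `d` in `δ`. -/
structure IsDualElement (S : Set G) (δ : G) (d : ℕ) : Prop where
  conjStable : ConjStable S δ
  exists_complement : ∀ a ∈ S, ∃ X, PositiveOfLength S d X ∧ δ = a * X

variable {d : ℕ}

/-- An inverse of a positive element of length `m` is `δ⁻ᵐ` times a positive element. -/
lemma IsDualElement.exists_inv_eq (hδ : IsDualElement S δ d) {m : ℕ} {g : G}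
    (hg : PositiveOfLength S m g) :
    ∃ h, PositiveOfLength S (m * d) h ∧ g⁻¹ = δ ^ (-(m : ℤ)) * h := by
  induction m generalizing g with
  | zero => exact ⟨1, by simpa using PositiveOfLength.one, by simp [hg.eq_one]⟩
  | succ m ih =>
    obtain ⟨a, ha, y, hy, rfl⟩ := hg.exists_cons
    obtain ⟨h, hh, e⟩ := ih hy
    obtain ⟨X, hX, eX⟩ := hδ.exists_complement a ha
    -- Since `a⁻¹ = X * δ⁻¹`, the trailing `δ⁻¹` has to be carried leftwards past `h * X`.
    obtain ⟨h', hh', e'⟩ := hδ.conjStable.exists_mul_zpow (-1) (hh.mul hX)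
    refine ⟨h', by rw [add_one_mul]; exact hh', ?_⟩
    have ea : a⁻¹ = X * δ⁻¹ := by rw [eX]; group
    have : δ ^ (-((m + 1 : ℕ) : ℤ)) = δ ^ (-(m : ℤ)) * δ ^ (-1 : ℤ) := by
      rw [← zpow_add]; congr 1; push_cast; ring
    rw [mul_inv_rev, e, ea, this, mul_assoc _ _ h', ← e']
    simp [mul_assoc]

/-- A positive element of length `m` is `δᵐ` times the inverse of a positive element. -/
lemma IsDualElement.exists_eq_mul_inv (hδ : IsDualElement S δ d) {m : ℕ} {g : G}
    (hg : PositiveOfLength S m g) :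
    ∃ h, PositiveOfLength S (m * d) h ∧ g = δ ^ (m : ℤ) * h⁻¹ := by
  obtain ⟨h, hh, e⟩ := hδ.exists_inv_eq hg
  obtain ⟨h', hh', e'⟩ := hδ.conjStable.exists_zpow_mul (-(m : ℤ)) hh
  refine ⟨h', hh', ?_⟩
  rw [← inv_inv g, e, e']
  simp

end BandMonoid

/-! ### Descending products, bands and conjugation by `δ`. -/

namespace BraidGroup

variable {n : ℕ}

lemma sigma_mul_comm {i j : ℕ} (h : i + 1 < j) : sigma n i * sigma n j = sigma n j * sigma n i := by
  unfold sigma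
  split_ifs with hi hj hj <;> try simp
  refine mul_inv_eq_one.1 (PresentedGroup.one_of_mem (rels := artinRelators n) ?_)
  exact Or.inl ⟨⟨i, hi⟩, ⟨j, hj⟩, h, rfl⟩

lemma sigma_braid {i : ℕ} (hi : 1 ≤ i) (hin : i + 1 < n) :
    sigma n i * sigma n (i + 1) * sigma n i = sigma n (i + 1) * sigma n i * sigma n (i + 1) := by
  have h₁ : 1 ≤ i ∧ i < n := ⟨hi, by omega⟩
  have h₂ : 1 ≤ i + 1 ∧ i + 1 < n := ⟨by omega, hin⟩
  simp only [sigma, dif_pos h₁, dif_pos h₂]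
  refine mul_inv_eq_one.1 (PresentedGroup.one_of_mem (rels := artinRelators n) ?_)
  exact Or.inr ⟨⟨i, h₁⟩, ⟨i + 1, h₂⟩, rfl, rfl⟩

/-- `descent n i k = σ_{i+k-1} ⋯ σ_{i+1} σ_i`, a product of `k` generators. -/
def descent (n i : ℕ) : ℕ → BraidGroup n
  | 0 => 1
  | k + 1 => sigma n (i + k) * descent n i k

lemma sigmaDesc_eq_descent {i : ℕ} (k : ℕ) (h : 1 ≤ i + k) :
    sigmaDesc n i (i + k - 1) = descent n i k := by
  induction k with
  | zero => simp [sigmaDesc, descent, show i - 1 + 1 - i = 0 by omega]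
  | succ k ih =>
    rw [descent]
    by_cases hk : 1 ≤ i + k
    · rw [← ih hk]
      unfold sigmaDesc
      rw [show i + (k + 1) - 1 + 1 - i = k + 1 by omega, show i + k - 1 + 1 - i = k by omega,
        List.range_succ_eq_map, List.map_cons, List.prod_cons, List.map_map]
      congr 2
      refine List.map_congr_left fun t _ => ?_
      simp only [Function.comp]
      congr 1
      omega
    · obtain rfl : i = 0 := by omega
      obtain rfl : k = 0 := by omega
      simp [sigmaDesc, descent]

lemma descent_add (i k l : ℕ) : descent n i (k + l) = descent n (i + k) l * descent n i k := by
  induction l with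
  | zero => simp [descent]
  | succ l ih => rw [← add_assoc, descent, ih, descent, mul_assoc, add_assoc]

lemma descent_succ' (i k : ℕ) : descent n i (k + 1) = descent n (i + 1) k * sigma n i := by
  rw [add_comm, descent_add]; simp [descent]

lemma sigma_mul_descent {i j : ℕ} (h : i + 1 < j) (k : ℕ) :
    sigma n i * descent n j k = descent n j k * sigma n i := by
  induction k with
  | zero => simp [descent]
  | succ k ih =>
    rw [descent, ← mul_assoc, sigma_mul_comm (by omega), mul_assoc, ih, mul_assoc]

lemma descent_mul_sigma {i j k : ℕ} (h : i + k < j) :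
    descent n i k * sigma n j = sigma n j * descent n i k := by
  induction k with
  | zero => simp [descent]
  | succ k ih =>
    rw [descent, mul_assoc, ih (by omega), ← mul_assoc, sigma_mul_comm (by omega), mul_assoc]

/-- The band generator `a_{i,i+k+1}`, as a quotient of two descending products. -/
def bandElem (n i k : ℕ) : BraidGroup n := descent n i (k + 1) * (descent n (i + 1) k)⁻¹

lemma band_eq_bandElem (p : BandIndex n) : band p = bandElem n p.1.1 (p.1.2 - p.1.1 - 1) := by
  obtain ⟨⟨i, j⟩, hi, hij, hj⟩ := p
  dsimp only at hi hij hj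
  obtain ⟨k, rfl⟩ : ∃ k, j = i + 1 + k := ⟨j - i - 1, by omega⟩
  rw [band, bandElem]
  simp only [show i + 1 + k - i - 1 = k by omega, sigmaDesc_eq_descent k (show 1 ≤ i + 1 + k by omega),
    descent_succ']

lemma mem_range_band_iff {g : BraidGroup n} :
    g ∈ Set.range (band (n := n)) ↔ ∃ i k, 1 ≤ i ∧ i + k + 1 ≤ n ∧ g = bandElem n i k := by
  constructor
  · rintro ⟨p, rfl⟩
    have := p.2
    exact ⟨p.1.1, p.1.2 - p.1.1 - 1, by omega, by omega, band_eq_bandElem p⟩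
  · rintro ⟨i, k, hi, hk, rfl⟩
    refine ⟨⟨(i, i + k + 1), hi, by dsimp only; omega, hk⟩, ?_⟩
    rw [band_eq_bandElem]
    dsimp only
    congr 1
    omega

lemma delta_eq_descent (hn : 1 ≤ n) : delta n = descent n 1 (n - 1) := by
  rw [delta, ← sigmaDesc_eq_descent _ (by omega)]
  congr 1
  omega

/-- Conjugation by `δ` lowers the indices of the Artin generators. -/
lemma delta_mul_sigma {i : ℕ} (hi : 1 ≤ i) (hin : i + 1 < n) :
    delta n * sigma n (i + 1) = sigma n i * delta n := by
  obtain ⟨l, rfl⟩ : ∃ l, n = i + 2 + l := ⟨n - i - 2, by omega⟩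
  obtain ⟨j, rfl⟩ : ∃ j, i = 1 + j := ⟨i - 1, by omega⟩
  have e : delta (1 + j + 2 + l) = descent (1 + j + 2 + l) (1 + j + 2) l *
      (sigma _ (1 + j + 1) * (sigma _ (1 + j) * descent _ 1 j)) := by
    rw [delta_eq_descent (by omega), show 1 + j + 2 + l - 1 = (j + 1 + 1) + l by omega, descent_add,
      descent, descent]
    rfl
  have hb := sigma_braid hi hin
  rw [e]
  calc _ = descent (1 + j + 2 + l) (1 + j + 2) l * (sigma _ (1 + j + 1) * (sigma _ (1 + j) *
        (descent _ 1 j * sigma _ (1 + j + 1)))) := by simp only [mul_assoc]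
    _ = descent (1 + j + 2 + l) (1 + j + 2) l * (sigma _ (1 + j + 1) * sigma _ (1 + j) *
        sigma _ (1 + j + 1)) * descent _ 1 j := by
      rw [descent_mul_sigma (by omega)]; simp only [mul_assoc]
    _ = descent (1 + j + 2 + l) (1 + j + 2) l * sigma _ (1 + j) * (sigma _ (1 + j + 1) *
        sigma _ (1 + j)) * descent _ 1 j := by rw [← hb]; simp only [mul_assoc]
    _ = _ := by rw [← sigma_mul_descent (by omega)]; simp only [mul_assoc]

lemma delta_mul_descent {i k : ℕ} (hi : 1 ≤ i) (hk : i + k < n) :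
    delta n * descent n (i + 1) k = descent n i k * delta n := by
  induction k with
  | zero => simp [descent]
  | succ k ih =>
    rw [descent, ← mul_assoc, add_right_comm, delta_mul_sigma (by omega) (by omega), mul_assoc,
      ih (by omega), descent, mul_assoc]

lemma delta_conj_bandElem {i k : ℕ} (hi : 1 ≤ i) (hk : i + k + 1 < n) :
    delta n * bandElem n (i + 1) k * (delta n)⁻¹ = bandElem n i k := by
  have h₁ := delta_mul_descent (n := n) (i := i) (k := k + 1) hi (by omega)
  have h₂ := delta_mul_descent (n := n) (i := i + 1) (k := k) (by omega) (by omega)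
  have h₃ : (descent n (i + 1 + 1) k)⁻¹ * (delta n)⁻¹ = (delta n)⁻¹ * (descent n (i + 1) k)⁻¹ := by
    rw [← mul_inv_rev, h₂, mul_inv_rev]
  rw [bandElem, bandElem, ← mul_assoc, h₁, mul_assoc, h₃]
  group

/-- Conjugation by `σ_i` takes `a_{i,j}` to `a_{i+1,j}`. -/
lemma sigma_mul_bandElem {i k : ℕ} (hi : 1 ≤ i) (hin : i + 1 < n) :
    sigma n i * bandElem n i (k + 1) = bandElem n (i + 1) k * sigma n i := by
  rw [bandElem, bandElem, descent_succ' i, descent_succ' (i + 1), add_assoc]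
  have hc := sigma_mul_descent (n := n) (i := i) (j := i + (1 + 1)) (by omega) k
  have hb := sigma_braid hi hin
  set E := descent n (i + (1 + 1)) k
  calc _ = (sigma n i * E) * sigma n (i + 1) * sigma n i * (sigma n (i + 1))⁻¹ * E⁻¹ := by group
    _ = E * (sigma n i * sigma n (i + 1) * sigma n i) * (sigma n (i + 1))⁻¹ * E⁻¹ := by
      rw [hc]; group
    _ = E * sigma n (i + 1) * (sigma n i * E⁻¹) := by rw [hb]; group
    _ = _ := by
      rw [show sigma n i * E⁻¹ = E⁻¹ * sigma n i by rw [mul_inv_eq_iff_eq_mul, mul_assoc, hc]; group]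
      group

/-- Iterating `sigma_mul_bandElem` slides the left end of a band `l` steps to the right; its right
end stays fixed. -/
lemma descent_mul_bandElem {i k l : ℕ} (hi : 1 ≤ i) (hn : i + l < n) :
    descent n i l * bandElem n i (k + l) = bandElem n (i + l) k * descent n i l := by
  induction l generalizing k with
  | zero => simp [descent]
  | succ l ih =>
    rw [descent, mul_assoc, show k + (l + 1) = k + 1 + l by omega, ih (by omega), ← mul_assoc,
      sigma_mul_bandElem (by omega) (by omega), mul_assoc, add_assoc]

/-- The wrap-around case: `a_{1,k+2}` goes to `a_{k+1,n}`. For `σ_1` this is the identity `δ σ_1 =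
a_{1,n} δ`; in general `a_{1,k+2}` is a conjugate of `σ_1`, and the shifted conjugator slides the
left end of `a_{1,n}` to `k + 1`. -/
lemma delta_conj_bandElem_one {k : ℕ} (hk : k + 2 ≤ n) :
    delta n * bandElem n 1 k * (delta n)⁻¹ = bandElem n (k + 1) (n - k - 2) := by
  obtain ⟨l, rfl⟩ : ∃ l, n = k + 2 + l := ⟨n - k - 2, by omega⟩
  rw [show k + 2 + l - k - 2 = l by omega]
  have e : delta (k + 2 + l) = descent _ 1 (l + k + 1) := by
    rw [delta_eq_descent (by omega)]; congr 1; omega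
  have h₁ : delta (k + 2 + l) * sigma _ 1 = bandElem _ 1 (l + k) * delta _ := by
    rw [bandElem, ← e, e, descent_succ' 1 (l + k)]; group
  have h₂ := delta_mul_descent (n := k + 2 + l) (i := 1) (k := k) le_rfl (by omega)
  have h₃ := descent_mul_bandElem (n := k + 2 + l) (i := 1) (k := l) (l := k) le_rfl (by omega)
  rw [mul_inv_eq_iff_eq_mul]
  calc delta _ * bandElem (k + 2 + l) 1 k
      = delta _ * descent _ 2 k * sigma _ 1 * (descent _ 2 k)⁻¹ := by
        rw [bandElem, descent_succ']; group
    _ = descent _ 1 k * bandElem _ 1 (l + k) * (delta _ * (descent _ 2 k)⁻¹) := by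
        rw [h₂, mul_assoc (descent _ 1 k) (delta _), h₁]; group
    _ = bandElem _ (1 + k) l * descent _ 1 k * ((descent _ 1 k)⁻¹ * delta _) := by
        rw [h₃, show delta (k + 2 + l) * (descent _ 2 k)⁻¹ = (descent _ 1 k)⁻¹ * delta _ by
          rw [mul_inv_eq_iff_eq_mul, mul_assoc, h₂]; group]
    _ = _ := by rw [add_comm 1 k]; group

/-- With bands viewed as chords of an `n`-gon, conjugation by `δ` is the rotation lowering both
indices by one modulo `n`. -/
lemma conjStable_delta : ConjStable (Set.range (band (n := n))) (delta n) := by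
  intro a ha
  rw [mem_range_band_iff] at ha
  obtain ⟨i, k, hi, hk, rfl⟩ := ha
  rw [mem_range_band_iff, mem_range_band_iff]
  constructor
  · obtain ⟨i, rfl⟩ : ∃ t, i = t + 1 := ⟨i - 1, by omega⟩
    by_cases h : i = 0
    · subst h
      exact ⟨k + 1, n - k - 2, by omega, by omega, delta_conj_bandElem_one (by omega)⟩
    · exact ⟨i, k, by omega, by omega, delta_conj_bandElem (by omega) (by omega)⟩
  · by_cases h : i + k + 1 < n
    · refine ⟨i + 1, k, by omega, by omega, ?_⟩
      rw [← delta_conj_bandElem hi h]; group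
    -- Here the right end is `n`, so the inverse rotation wraps `a_{i,n}` to `a_{1,i+1}`.
    · refine ⟨1, i - 1, by omega, by omega, ?_⟩
      have e := delta_conj_bandElem_one (n := n) (k := i - 1) (by omega)
      rw [show i - 1 + 1 = i by omega, show n - (i - 1) - 2 = k by omega] at e
      rw [← e]; group

lemma sigma_mem_range_band {i : ℕ} (hi : 1 ≤ i) (hin : i < n) :
    sigma n i ∈ Set.range (band (n := n)) :=
  mem_range_band_iff.2 ⟨i, 0, hi, hin, by simp [bandElem, descent]⟩

lemma positiveOfLength_descent {i k : ℕ} (hi : 1 ≤ i) (hk : i + k ≤ n) :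
    PositiveOfLength (Set.range (band (n := n))) k (descent n i k) := by
  induction k with
  | zero => exact PositiveOfLength.one
  | succ k ih =>
    rw [descent, add_comm k 1]
    exact (PositiveOfLength.of_mem (sigma_mem_range_band (by omega) (by omega))).mul
      (ih (by omega))

/-- The band occurs inside `δ` as `δ = P * a * Q` with `P`, `Q` positive of total length `n - 2`.
Moving `P` around to the right end gives `δ = a * (Q * (δ⁻¹ * P * δ))`. -/
lemma isDualElement_delta : IsDualElement (Set.range (band (n := n))) (delta n) (n - 2) where
  conjStable := conjStable_delta
  exists_complement a ha := by
    obtain ⟨i, k, hi, hk, rfl⟩ := mem_range_band_iff.1 ha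
    obtain ⟨l, rfl⟩ : ∃ l, n = i + k + 1 + l := ⟨n - i - k - 1, by omega⟩
    obtain ⟨i, rfl⟩ : ∃ t, i = 1 + t := ⟨i - 1, by omega⟩
    set N := 1 + i + k + 1 + l
    have hP : PositiveOfLength (Set.range (band (n := N))) l (descent N (1 + i + (k + 1)) l) :=
      positiveOfLength_descent (by omega) (by omega)
    have hQ : PositiveOfLength (Set.range (band (n := N))) (k + i)
        (descent N (1 + i + 1) k * descent N 1 i) :=
      (positiveOfLength_descent (by omega) (by omega)).mul
        (positiveOfLength_descent (by omega) (by omega))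
    have e : delta N = descent N (1 + i + (k + 1)) l * (bandElem N (1 + i) k *
        (descent N (1 + i + 1) k * descent N 1 i)) := by
      rw [delta_eq_descent (by omega), show N - 1 = i + (k + 1 + l) by omega, descent_add,
        descent_add, bandElem]
      group
    have hP' := hP.conj (h := (delta N)⁻¹) fun a ha => by
      simpa using (conjStable_delta a ha).2
    refine ⟨_, by convert hQ.mul hP' using 1; omega, ?_⟩
    generalize descent N (1 + i + (k + 1)) l = P at *
    generalize descent N (1 + i + 1) k * descent N 1 i = Q at *
    rw [e]
    group

/-! ### The writhe of positive braids and of `δ`. -/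

lemma exponentSum_sigma {i : ℕ} (hi : 1 ≤ i) (hin : i < n) :
    exponentSum n (sigma n i) = Multiplicative.ofAdd 1 := by
  have h : 1 ≤ i ∧ i < n := ⟨hi, hin⟩
  rw [sigma, dif_pos h]
  exact PresentedGroup.toGroup.of _

lemma writhe_mul (g h : BraidGroup n) : writhe (g * h) = writhe g + writhe h := by
  simp [writhe]

lemma writhe_inv (g : BraidGroup n) : writhe g⁻¹ = -writhe g := by
  simp [writhe]

lemma writhe_zpow (g : BraidGroup n) (r : ℤ) : writhe (g ^ r) = r * writhe g := by
  simp [writhe]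

lemma writhe_band (p : BandIndex n) : writhe (band p) = 1 := by
  have h : writhe (sigma n p.1.1) = 1 :=
    congrArg Multiplicative.toAdd (exponentSum_sigma p.2.1 (p.2.2.1.trans_le p.2.2.2))
  rw [band, writhe_mul, writhe_mul, writhe_inv, h]
  ring

lemma writhe_eq_of_positiveOfLength {m : ℕ} {g : BraidGroup n}
    (hg : PositiveOfLength (Set.range band) m g) : writhe g = m :=
  hg.map_eq (w := exponentSum n) (by rintro _ ⟨p, rfl⟩; exact writhe_band p)

lemma writhe_delta (hn : 1 ≤ n) : writhe (delta n) = n - 1 := by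
  rw [delta_eq_descent hn,
    writhe_eq_of_positiveOfLength (positiveOfLength_descent le_rfl (by omega))]
  push_cast [hn]; ring

/-! ### One-sided forms of the order relative to powers of `δ`. -/

/-- Positive factors pass through powers of `δ` without changing length, so both can be gathered on
the right. -/
lemma below_delta_zpow_iff {r : ℤ} {β : BraidGroup n} :
    Below (delta n ^ r) β ↔
      ∃ m P, PositiveOfLength (Set.range band) m P ∧ β = delta n ^ r * P := by
  constructor
  · rintro ⟨P, hP, Q, hQ, rfl⟩
    obtain ⟨p, hP⟩ := mem_closure_iff_positiveOfLength.1 hP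
    obtain ⟨q, hQ⟩ := mem_closure_iff_positiveOfLength.1 hQ
    obtain ⟨P', hP', e⟩ := conjStable_delta.exists_mul_zpow r hP
    exact ⟨_, _, hP'.mul hQ, by rw [e, mul_assoc]⟩
  · rintro ⟨m, P, hP, rfl⟩
    exact ⟨1, one_mem _, P, mem_closure_iff_positiveOfLength.2 ⟨m, hP⟩, by simp⟩

lemma below_iff_eq_delta_zpow_mul_inv {s : ℤ} {β : BraidGroup n} :
    Below β (delta n ^ s) ↔
      ∃ m R, PositiveOfLength (Set.range band) m R ∧ β = delta n ^ s * R⁻¹ := by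
  constructor
  · rintro ⟨P, hP, Q, hQ, e⟩
    obtain ⟨p, hP⟩ := mem_closure_iff_positiveOfLength.1 hP
    obtain ⟨q, hQ⟩ := mem_closure_iff_positiveOfLength.1 hQ
    obtain ⟨P', hP', e'⟩ := conjStable_delta.exists_mul_zpow s hP
    refine ⟨_, _, hQ.mul hP', ?_⟩
    have h : β = P⁻¹ * delta n ^ s * Q⁻¹ := by rw [e]; group
    have h' : P⁻¹ * delta n ^ s = delta n ^ s * P'⁻¹ := by
      rw [inv_mul_eq_iff_eq_mul, ← mul_assoc, e', mul_inv_cancel_right]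
    rw [h, h', mul_inv_rev, mul_assoc]
  · rintro ⟨m, R, hR, rfl⟩
    exact ⟨1, one_mem _, R, mem_closure_iff_positiveOfLength.2 ⟨m, hR⟩, by simp⟩

/-! ### Band words and their negative letters. -/

lemma toBraid_true_cons (p : BandIndex n) (W : BandWord n) :
    BandWord.toBraid ((p, true) :: W) = band p * W.toBraid := by
  simp [BandWord.toBraid]

lemma toBraid_false_cons (p : BandIndex n) (W : BandWord n) :
    BandWord.toBraid ((p, false) :: W) = (band p)⁻¹ * W.toBraid := by
  simp [BandWord.toBraid]

lemma nb_true_cons (p : BandIndex n) (W : BandWord n) :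
    BandWord.nb ((p, true) :: W) = W.nb := by
  simp [BandWord.nb]

lemma nb_false_cons (p : BandIndex n) (W : BandWord n) :
    BandWord.nb ((p, false) :: W) = W.nb + 1 := by
  simp [BandWord.nb]

/-- A word with `m` negative bands represents `δ⁻ᵐ` times a positive braid. -/
lemma exists_eq_delta_zpow_mul (W : BandWord n) :
    ∃ m P, PositiveOfLength (Set.range band) m P ∧ W.toBraid = delta n ^ (-(W.nb : ℤ)) * P := by
  induction W with
  | nil => exact ⟨0, 1, PositiveOfLength.one, by simp [BandWord.toBraid, BandWord.nb]⟩
  | cons x W ih =>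
    obtain ⟨m, P, hP, e⟩ := ih
    obtain ⟨p, b⟩ := x
    have hp : PositiveOfLength (Set.range (band (n := n))) 1 (band p) :=
      PositiveOfLength.of_mem ⟨p, rfl⟩
    cases b
    · obtain ⟨h, hh, eh⟩ := isDualElement_delta.exists_inv_eq hp
      obtain ⟨h', hh', eh'⟩ := conjStable_delta.exists_mul_zpow (-(BandWord.nb W : ℤ)) hh
      refine ⟨_, _, hh'.mul hP, ?_⟩
      rw [toBraid_false_cons, nb_false_cons, e, eh, mul_assoc, ← mul_assoc h, eh', mul_assoc,
        ← mul_assoc, ← zpow_add]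
      congr 2
      push_cast; ring
    · obtain ⟨h', hh', eh'⟩ := conjStable_delta.exists_mul_zpow (-(BandWord.nb W : ℤ)) hp
      refine ⟨_, _, hh'.mul hP, ?_⟩
      rw [toBraid_true_cons, nb_true_cons, e, ← mul_assoc, eh', mul_assoc]

lemma toBraid_append (V W : BandWord n) :
    BandWord.toBraid (V ++ W) = V.toBraid * W.toBraid := by
  simp [BandWord.toBraid]

lemma nb_append (V W : BandWord n) : BandWord.nb (V ++ W) = V.nb + W.nb := by
  simp [BandWord.nb]

lemma neg_nb_le_writhe (W : BandWord n) : -(W.nb : ℤ) ≤ writhe W.toBraid := by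
  induction W with
  | nil => simp [BandWord.toBraid, BandWord.nb, writhe]
  | cons x W ih =>
    obtain ⟨p, b⟩ := x
    cases b
    · rw [toBraid_false_cons, nb_false_cons, writhe_mul, writhe_inv, writhe_band]
      push_cast; linarith
    · rw [toBraid_true_cons, nb_true_cons, writhe_mul, writhe_band]
      linarith

lemma exists_word_of_positiveOfLength {m : ℕ} {g : BraidGroup n}
    (hg : PositiveOfLength (Set.range band) m g) : ∃ W : BandWord n, W.toBraid = g ∧ W.nb = 0 := by
  induction m generalizing g with
  | zero => exact ⟨[], by simp [BandWord.toBraid, hg.eq_one], by simp [BandWord.nb]⟩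
  | succ m ih =>
    obtain ⟨_, ⟨p, rfl⟩, y, hy, rfl⟩ := hg.exists_cons
    obtain ⟨W, rfl, hW⟩ := ih hy
    exact ⟨(p, true) :: W, by simp [BandWord.toBraid], by simpa [BandWord.nb] using hW⟩

lemma exists_word_inv_of_positiveOfLength {m : ℕ} {g : BraidGroup n}
    (hg : PositiveOfLength (Set.range band) m g) :
    ∃ W : BandWord n, W.toBraid = g⁻¹ ∧ W.nb = m := by
  induction m generalizing g with
  | zero => exact ⟨[], by simp [BandWord.toBraid, hg.eq_one], by simp [BandWord.nb]⟩
  | succ m ih =>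
    obtain ⟨_, ⟨p, rfl⟩, y, hy, rfl⟩ := hg.exists_cons
    obtain ⟨W, hW, hm⟩ := ih hy
    refine ⟨W ++ [(p, false)], ?_, ?_⟩
    · rw [toBraid_append, hW]; simp [BandWord.toBraid]
    · rw [nb_append, hm]; simp [BandWord.nb]

/-- Makes the set defining `nb` nonempty, so that its `sInf` is a true minimum and not the default
`0`; it likewise supplies a power of `δ` below each braid. -/
lemma exists_word (β : BraidGroup n) : ∃ W : BandWord n, W.toBraid = β := by
  refine PresentedGroup.induction_on (rels := artinRelators n)
    (C := fun β => ∃ W : BandWord n, W.toBraid = β) β fun x => ?_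
  induction x using FreeGroup.induction_on with
  | C1 => exact ⟨[], rfl⟩
  | of i =>
    obtain ⟨p, hp⟩ := sigma_mem_range_band (n := n) i.2.1 i.2.2
    refine ⟨[(p, true)], ?_⟩
    simp only [BandWord.toBraid, List.map_cons, List.map_nil, List.prod_singleton, if_true, hp]
    rw [sigma, dif_pos i.2]
    rfl
  | inv_of i _ =>
    obtain ⟨p, hp⟩ := sigma_mem_range_band (n := n) i.2.1 i.2.2
    refine ⟨[(p, false)], ?_⟩
    simp only [BandWord.toBraid, List.map_cons, List.map_nil, List.prod_singleton, hp]
    rw [sigma, dif_pos i.2]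
    rfl
  | mul x y hx hy =>
    obtain ⟨V, hV⟩ := hx
    obtain ⟨W, hW⟩ := hy
    exact ⟨V ++ W, by rw [toBraid_append, hV, hW]; rfl⟩

lemma nb_le {W : BandWord n} {β : BraidGroup n} (h : W.toBraid = β) : nb β ≤ W.nb :=
  Nat.sInf_le ⟨W, h, rfl⟩

lemma exists_word_nb (β : BraidGroup n) : ∃ W : BandWord n, W.toBraid = β ∧ W.nb = nb β := by
  obtain ⟨W, hW⟩ := exists_word β
  exact Nat.sInf_mem (s := {m : ℕ | ∃ W : BandWord n, W.toBraid = β ∧ W.nb = m}) ⟨_, W, hW, rfl⟩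

/-! ### `inf` and `sup` are attained. -/

/-- If `β = δ ^ r * P`, then `writhe β ≥ r * (n - 1)`, which bounds every positive `r`. -/
lemma bddAbove_delta_zpow_below (hn : 2 ≤ n) (β : BraidGroup n) :
    BddAbove {r : ℤ | Below (delta n ^ r) β} := by
  refine ⟨|writhe β|, fun r hr => ?_⟩
  obtain ⟨m, P, hP, rfl⟩ := below_delta_zpow_iff.1 hr
  rw [writhe_mul, writhe_zpow, writhe_delta (by omega), writhe_eq_of_positiveOfLength hP]
  have h₁ : (2 : ℤ) ≤ n := by exact_mod_cast hn
  by_cases h : r ≤ 0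
  · exact h.trans (abs_nonneg _)
  · refine le_trans ?_ (le_abs_self _)
    nlinarith

/-- `δ ^ inf β` lies below `β`. -/
lemma below_delta_zpow_inf (hn : 2 ≤ n) (β : BraidGroup n) : Below (delta n ^ β.inf) β := by
  refine Int.csSup_mem (s := {r : ℤ | Below (delta n ^ r) β}) ?_ (bddAbove_delta_zpow_below hn β)
  obtain ⟨W, rfl⟩ := exists_word β
  exact ⟨_, below_delta_zpow_iff.2 (exists_eq_delta_zpow_mul W)⟩

lemma le_inf (hn : 2 ≤ n) {r : ℤ} {β : BraidGroup n} (h : Below (delta n ^ r) β) : r ≤ β.inf :=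
  le_csSup (bddAbove_delta_zpow_below hn β) h

lemma bddBelow_below_delta_zpow (hn : 2 ≤ n) (β : BraidGroup n) :
    BddBelow {s : ℤ | Below β (delta n ^ s)} := by
  refine ⟨-|writhe β|, fun s hs => ?_⟩
  obtain ⟨m, R, hR, rfl⟩ := below_iff_eq_delta_zpow_mul_inv.1 hs
  rw [writhe_mul, writhe_zpow, writhe_delta (by omega), writhe_inv,
    writhe_eq_of_positiveOfLength hR]
  have h₁ : (2 : ℤ) ≤ n := by exact_mod_cast hn
  by_cases h : 0 ≤ s
  · exact le_trans (by simp) h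
  · have := neg_abs_le (s * ((n : ℤ) - 1) + -(m : ℤ))
    nlinarith

lemma below_delta_zpow_of_eq {r : ℤ} {m : ℕ} {P β : BraidGroup n}
    (hP : PositiveOfLength (Set.range band) m P) (h : β = delta n ^ r * P) :
    Below β (delta n ^ (r + m)) := by
  obtain ⟨R, hR, e⟩ := isDualElement_delta.exists_eq_mul_inv hP
  exact below_iff_eq_delta_zpow_mul_inv.2 ⟨_, R, hR, by rw [h, e, zpow_add, mul_assoc]⟩

lemma sup_le (hn : 2 ≤ n) {s : ℤ} {β : BraidGroup n} (h : Below β (delta n ^ s)) : β.sup ≤ s :=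
  csInf_le (bddBelow_below_delta_zpow hn β) h

/-- `β` lies below `δ ^ sup β`. -/
lemma below_delta_zpow_sup (hn : 2 ≤ n) (β : BraidGroup n) : Below β (delta n ^ β.sup) := by
  refine Int.csInf_mem (s := {s : ℤ | Below β (delta n ^ s)}) ?_ (bddBelow_below_delta_zpow hn β)
  obtain ⟨m, P, hP, e⟩ := below_delta_zpow_iff.1 (below_delta_zpow_inf hn β)
  exact ⟨_, below_delta_zpow_of_eq hP e⟩

/-! ### Bounds on the negative band number. -/

/-- The negative band number is at least `-inf`. -/
lemma neg_inf_le_nb (hn : 2 ≤ n) (β : BraidGroup n) : -β.inf ≤ nb β := by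
  obtain ⟨W, rfl, h⟩ := exists_word_nb β
  have := le_inf hn (below_delta_zpow_iff.2 (exists_eq_delta_zpow_mul W))
  rw [← h]
  linarith

lemma neg_writhe_le_nb (β : BraidGroup n) : -writhe β ≤ nb β := by
  obtain ⟨W, rfl, h⟩ := exists_word_nb β
  have := neg_nb_le_writhe W
  rw [← h]
  linarith

/-- Cancelling each of `k` factors `δ⁻¹` against one band leaves `k (n - 2)` negative bands. -/
lemma nb_delta_zpow_mul_le {k m : ℕ} (hkm : k ≤ m) {P : BraidGroup n}
    (hP : PositiveOfLength (Set.range band) m P) :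
    nb (delta n ^ (-(k : ℤ)) * P) ≤ k * (n - 2) := by
  obtain ⟨t, rfl⟩ := Nat.exists_eq_add_of_le hkm
  obtain ⟨x, y, hx, hy, rfl⟩ := hP.exists_mul
  obtain ⟨R, hR, e⟩ := isDualElement_delta.exists_eq_mul_inv hx
  obtain ⟨V, hV, hVn⟩ := exists_word_inv_of_positiveOfLength hR
  obtain ⟨W, hW, hWn⟩ := exists_word_of_positiveOfLength hy
  have := nb_le (W := V ++ W) (β := delta n ^ (-(k : ℤ)) * (x * y)) (by
    rw [toBraid_append, hV, hW, e]; simp [mul_assoc])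
  rwa [nb_append, hVn, hWn, add_zero] at this

/-- When `sup β ≤ 0`, the factor `δ ^ sup β` is itself the inverse of a positive braid. Thus `β` has
a word with negative letters only, and no word has fewer negative letters than `-writhe β`. -/
lemma nb_eq_neg_writhe (hn : 2 ≤ n) {β : BraidGroup n} (h : β.sup ≤ 0) :
    (nb β : ℤ) = -writhe β := by
  refine le_antisymm ?_ (neg_writhe_le_nb β)
  obtain ⟨m, R, hR, e⟩ := below_iff_eq_delta_zpow_mul_inv.1 (below_delta_zpow_sup hn β)
  obtain ⟨s, hs⟩ : ∃ s : ℕ, -β.sup = s := Int.eq_ofNat_of_zero_le (neg_nonneg.2 h)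
  have hD : PositiveOfLength (Set.range (band (n := n))) (n - 1) (delta n) := by
    rw [delta_eq_descent (by omega)]
    exact positiveOfLength_descent le_rfl (by omega)
  have hRD := hR.mul (hD.pow s)
  have e' : β = (R * delta n ^ s)⁻¹ := by
    rw [mul_inv_rev, ← zpow_natCast, ← zpow_neg, ← hs, neg_neg]
    exact e
  obtain ⟨W, hW, hWn⟩ := exists_word_inv_of_positiveOfLength hRD
  have := nb_le (hW.trans e'.symm)
  rw [e', writhe_inv, neg_neg, writhe_eq_of_positiveOfLength hRD, ← e', ← hWn]
  exact_mod_cast this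

/-- For three strands, if `β = δ ^ inf β * P` with `P` positive, then `length P ≤ sup β - inf β`. -/
lemma length_le_sup_sub_inf {β P : BraidGroup 3} {m : ℕ}
    (hP : PositiveOfLength (Set.range band) m P) (h : β = delta 3 ^ β.inf * P) :
    (m : ℤ) ≤ β.sup - β.inf := by
  obtain ⟨r, R, hR, e⟩ :=
    below_iff_eq_delta_zpow_mul_inv.1 (below_delta_zpow_sup (by norm_num) β)
  obtain ⟨Q, hQ, eQ⟩ := isDualElement_delta.exists_inv_eq hR
  have h₁ : Below (delta 3 ^ (β.sup + -(r : ℤ))) β :=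
    below_delta_zpow_iff.2 ⟨_, Q, hQ, by rw [zpow_add, mul_assoc, ← eQ]; exact e⟩
  have h₂ := le_inf (by norm_num) h₁
  -- Computing the writhe in both ways gives `m = 2 * (sup β - inf β) - r`, and `h₂` says `r ≥ sup β
  -- - inf β`. Three strands enter through `writhe δ = 2`.
  have w₁ := congrArg writhe h
  have w₂ := congrArg writhe e
  rw [writhe_mul, writhe_zpow, writhe_delta (by norm_num),
    writhe_eq_of_positiveOfLength hP] at w₁
  rw [writhe_mul, writhe_zpow, writhe_delta (by norm_num), writhe_inv,
    writhe_eq_of_positiveOfLength hR] at w₂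
  push_cast at w₁ w₂
  linarith

end BraidGroup

theorem theorem4p2 (n : ℕ) (hn : 3 ≤ n) (β : BraidGroup n) (hβ : β.inf ≤ -1) :
    (β.inf < 0 ∧ 0 < β.sup →
      (β.nb : ℤ) ≤ ((n : ℤ) - 2) * |β.inf|) ∧
    (β.sup ≤ 0 →
      (β.nb : ℤ) = -β.writhe ∧
      -β.writhe ≤ ((n : ℤ) - 2) * |β.inf| + |β.sup|) ∧
    (n = 3 →
      (β.inf < 0 ∧ 0 < β.sup →
        (β.nb : ℤ) = ((n : ℤ) - 2) * |β.inf|) ∧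
      (β.sup ≤ 0 →
        (β.nb : ℤ) = -β.writhe ∧
        -β.writhe = ((n : ℤ) - 2) * |β.inf| + |β.sup|)) := by
  have hn₂ : 2 ≤ n := by omega
  obtain ⟨m, P, hP, e⟩ := below_delta_zpow_iff.1 (below_delta_zpow_inf hn₂ β)
  have hsup := sup_le hn₂ (below_delta_zpow_of_eq hP e)
  have hw : writhe β = β.inf * (n - 1) + m := by
    conv_lhs => rw [e]
    rw [writhe_mul, writhe_zpow, writhe_delta (by omega), writhe_eq_of_positiveOfLength hP]
  have hinf : |β.inf| = -β.inf := abs_of_neg (by omega)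
  have mixed : 0 < β.sup → (β.nb : ℤ) ≤ ((n : ℤ) - 2) * |β.inf| := by
    intro hs
    obtain ⟨k, hk⟩ := Int.eq_ofNat_of_zero_le (show 0 ≤ -β.inf by omega)
    -- The condition `k ≤ m` comes from `0 < sup β ≤ inf β + m`.
    have h := nb_delta_zpow_mul_le (k := k) (by omega) hP
    rw [← hk, neg_neg, ← e] at h
    rw [hinf, hk]
    calc (β.nb : ℤ) ≤ ((k * (n - 2) : ℕ) : ℤ) := by exact_mod_cast h
      _ = _ := by push_cast [hn₂]; ring
  refine ⟨fun h => mixed h.2, fun h => ⟨nb_eq_neg_writhe hn₂ h, ?_⟩, ?_⟩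
  · rw [hw, hinf, abs_of_nonpos h]
    linarith
  · rintro rfl
    refine ⟨fun h => le_antisymm (mixed h.2) ?_, fun h => ⟨nb_eq_neg_writhe hn₂ h, ?_⟩⟩
    · have := neg_inf_le_nb hn₂ β
      rw [hinf]
      push_cast
      linarith
    -- Together with `hsup` this forces `m = sup β - inf β`, which turns the writhe bound into an
    -- equality.
    · have := length_le_sup_sub_inf hP e
      rw [hw, hinf, abs_of_nonpos h]
      push_cast
      linarith
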